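/- Let $\gamma,b:[0,\infty)\to(0,1]$ be continuous with $b(x)+\gamma(x)\le 1$ for all $x$, and let $\beta$ be a probability density on $[0,\infty)$ with support $(0,a+1)$ for some $0\le a\le\infty$ (that is, up to a Lebesgue-null set, $\{\beta>0\}=(0,a+1)$). Let $(X_n)_{n\ge0}$ be the Markov chain on $\mathbb{R}^+=[0,\infty)$ with one-step transition kernel $$P(0,dy)=\beta(y)\,dy,\qquad P(x,dy)=\gamma(x)\,\delta_0(dy)+b(x)\,\delta_{x+1}(dy)+(1-\gamma(x)-b(x))\,\delta_x(dy)\quad(x>0).$$ For a Borel set $C\subseteq\mathbb{R}^+$ let $\tau_C^+=\inf\{n\ge1:X_n\in C\}$ (with $\inf\emptyset=\infty$). A Borel set $C$ is called petite if there are a probability distribution $(a_n)_{n\ge0}$ on $\{0,1,2,\dots\}$ and a non-zero measure $\nu$ with $\sum_{n\ge0}a_nP^n(x,B)\ge\nu(B)$ for all $x\in C$ and all Borel sets $B$. The chain is called strongly ergodic if $\sup_{x\ge0}\mathbb{E}_x\tau_C^+<\infty$ for some petite set $C$, and geometrically ergodic if $\sup_{x\in C}\mathbb{E}_x\,r^{\tau_C^+}<\infty$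 for some non-empty petite set $C$ and some $r>1$ (with $r^\infty=\infty$). Then: 1. if $\limsup_{x\to\infty}\gamma(x)=0$, then $(X_n)$ is not strongly ergodic; 2. if $\liminf_{x\to\infty}\gamma(x)>0$, then $(X_n)$ is strongly ergodic; 3. if $\limsup_{x\to\infty}\gamma(x)=0$ and $\liminf_{x\to\infty}b(x)>0$, then $(X_n)$ is not geometrically ergodic. -/

import Mathlib

open MeasureTheory ProbabilityTheory Filter
open scoped NNReal ENNReal

noncomputable section

namespace MarkovErgodicity

section General

variable {E : Type*} [MeasurableSpace E]

/-- The law `ℙ_x` on trajectories of the homogeneous Markov chain with one-step transition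
kernel `P` started at `x` (Ionescu-Tulcea). -/
def pathLaw (P : Kernel E E) [IsMarkovKernel P] (x : E) : Measure (ℕ → E) :=
  Kernel.traj (X := fun _ => E)
    (fun n => P.comap (fun h : Finset.Iic n → E => h ⟨n, Finset.mem_Iic.2 le_rfl⟩)
      (measurable_pi_apply _)) 0 (fun _ => x)

/-- The return time `τ_C⁺ = inf {n ≥ 1 : X_n ∈ C}`, equal to `⊤` if there is no such `n`. -/
def returnTime (C : Set E) (ω : ℕ → E) : ℕ∞ :=
  hittingAfter (fun (n : ℕ) (ω : ℕ → E) => ω n) C 1 ω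

/-- `r ^ t` for a possibly infinite time `t`, with `r ^ ∞ = ∞` (it is used for `r > 1` only). -/
def powTime (r : ℝ) (t : ℕ∞) : ℝ≥0∞ :=
  if t = ⊤ then ⊤ else ENNReal.ofReal r ^ t.toNat

/-- `𝔼_x τ_C⁺`. -/
def meanReturnTime (P : Kernel E E) [IsMarkovKernel P] (C : Set E) (x : E) : ℝ≥0∞ :=
  ∫⁻ ω, (returnTime C ω : ℝ≥0∞) ∂(pathLaw P x)

/-- `𝔼_x r ^ τ_C⁺`. -/
def expReturnTime (P : Kernel E E) [IsMarkovKernel P] (r : ℝ) (C : Set E) (x : E) : ℝ≥0∞ :=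
  ∫⁻ ω, powTime r (returnTime C ω) ∂(pathLaw P x)

/-- `C` is petite: it is measurable and, for some probability distribution `a` on `ℕ` and some
non-trivial measure `ν`, `∑ₙ aₙ Pⁿ(x, B) ≥ ν(B)` for all `x ∈ C` and all measurable `B`. -/
def IsPetite (P : Kernel E E) (C : Set E) : Prop :=
  MeasurableSet C ∧ ∃ (a : ℕ → ℝ≥0∞) (ν : Measure E), ∑' n, a n = 1 ∧ ν ≠ 0 ∧
    ∀ x ∈ C, ∀ B : Set E, MeasurableSet B → ν B ≤ ∑' n, a n * (P ^ n) x B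

/-- Strong (uniform) ergodicity: `sup_{x ∈ E} 𝔼_x τ_C⁺ < ∞` for some petite set `C`. -/
def IsStronglyErgodic (P : Kernel E E) [IsMarkovKernel P] : Prop :=
  ∃ C : Set E, IsPetite P C ∧ (⨆ x, meanReturnTime P C x) < ⊤

/-- Geometric ergodicity: `sup_{x ∈ C} 𝔼_x r ^ τ_C⁺ < ∞` for some petite set `C` and `r > 1`.
The empty set is petite and would satisfy this for no reason, so it is excluded. -/
def IsGeometricallyErgodic (P : Kernel E E) [IsMarkovKernel P] : Prop :=
  ∃ C : Set E, C.Nonempty ∧ IsPetite P C ∧ ∃ r : ℝ, 1 < r ∧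
    (⨆ x ∈ C, expReturnTime P r C x) < ⊤

end General

/-- Lebesgue measure on `ℝ⁺ = [0, ∞)`. -/
def lebesgue : Measure ℝ≥0 :=
  Measure.comap NNReal.toReal volume

/-- The parameters of the example chain on `ℝ⁺ = [0, ∞)`. -/
structure ChainParams where
  /-- probability of a jump from `x > 0` to `0` -/
  γ : ℝ≥0 → ℝ
  /-- probability of a jump from `x > 0` to `x + 1` -/
  b : ℝ≥0 → ℝ
  /-- density of the jump from `0` -/
  β : ℝ≥0 → ℝ≥0
  /-- the density lives on `(0, a + 1)`, where `a = ∞` is allowed -/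
  a : ℝ≥0∞
  continuous_γ : Continuous γ
  continuous_b : Continuous b
  γ_pos : ∀ x, 0 < γ x
  γ_le_one : ∀ x, γ x ≤ 1
  b_pos : ∀ x, 0 < b x
  b_le_one : ∀ x, b x ≤ 1
  add_le_one : ∀ x, b x + γ x ≤ 1
  measurable_β : Measurable β
  lintegral_β : ∫⁻ y, (β y : ℝ≥0∞) ∂lebesgue = 1
  support_β : ∀ᵐ y ∂lebesgue, 0 < β y ↔ 0 < y ∧ (y : ℝ≥0∞) < a + 1

namespace ChainParams

variable (D : ChainParams)

/-- The one-step transition probability `P(x, dy)`: `β(y) dy` if `x = 0`, and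
`γ(x) δ_0 + b(x) δ_{x+1} + (1 - γ(x) - b(x)) δ_x` if `x > 0`. -/
def step (x : ℝ≥0) : Measure ℝ≥0 :=
  if x = 0 then lebesgue.withDensity (fun y => (D.β y : ℝ≥0∞))
  else ENNReal.ofReal (D.γ x) • Measure.dirac 0 + ENNReal.ofReal (D.b x) • Measure.dirac (x + 1)
    + ENNReal.ofReal (1 - D.γ x - D.b x) • Measure.dirac x

theorem measurable_step : Measurable D.step := by
  have hγ := D.continuous_γ.measurable
  have hb := D.continuous_b.measurable
  refine Measurable.ite (measurableSet_singleton 0) measurable_const ?_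
  refine Measure.measurable_of_measurable_coe _ fun s hs => ?_
  simp only [Measure.add_apply, Measure.smul_apply, smul_eq_mul, Measure.dirac_apply' _ hs]
  have h1 : Measurable (s.indicator (1 : ℝ≥0 → ℝ≥0∞)) := measurable_one.indicator hs
  have h2 : Measurable fun x : ℝ≥0 => s.indicator (1 : ℝ≥0 → ℝ≥0∞) (x + 1) :=
    h1.comp (measurable_id.add_const 1)
  exact ((hγ.ennreal_ofReal.mul measurable_const).add (hb.ennreal_ofReal.mul h2)).add
    (((measurable_const.sub hγ).sub hb).ennreal_ofReal.mul h1)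

/-- The one-step transition kernel of the example chain. -/
def kernel : Kernel ℝ≥0 ℝ≥0 where
  toFun := D.step
  measurable' := D.measurable_step

instance : IsMarkovKernel D.kernel := by
  refine ⟨fun x => ⟨?_⟩⟩
  change D.step x Set.univ = 1
  unfold step
  split_ifs with h
  · simpa using D.lintegral_β
  · have h1 := D.γ_pos x
    have h2 := D.b_pos x
    have h3 := D.add_le_one x
    simp only [Measure.add_apply, Measure.smul_apply, smul_eq_mul, measure_univ, mul_one]
    rw [← ENNReal.ofReal_add h1.le h2.le, ← ENNReal.ofReal_add (by linarith) (by linarith)]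
    simp

end ChainParams

end MarkovErgodicity

end

/-! Everything is reduced to probabilities that the path stays in prescribed sets `A 0, …, A n`; by
the Markov property these multiply up one-step bounds. If the `A i` with `i ≥ 1` avoid `C`, such a
path has `τ_C⁺ > n`.

If `liminf γ > 0`, then `γ ≥ g > 0` everywhere, so away from `0` the chain is killed at rate at
least `g` per step and the return time to the petite set `{0}` has a geometric tail, uniformly in
the start.

If `γ → 0`, mass started far out stays far out for any fixed number of steps, so petite sets are
bounded (`bddAbove_of_isPetite`). Beyond a high level `L`, the chain survives `n` steps with
probability at least `(1 - ε)^n`. Starting at `L` with `ε` of order `1/n` makes mean return times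
unbounded. For exponential moments the start must lie in `C`: some point of `C` reaches level `L`
off `C` with positive probability, and then `r (1 - ε) > 1` makes the moment infinite
(`expReturnTime_eq_top`). -/

namespace MarkovErgodicity

/-! ### Paths confined to prescribed sets, and return times -/

section General

variable {E : Type*} [MeasurableSpace E]

/-- The trajectories whose position at each time `i ≤ n` lies in `A i`. -/
def stayIn (A : ℕ → Set E) (n : ℕ) : Set (ℕ → E) := {ω | ∀ i ≤ n, ω i ∈ A i}

theorem measurableSet_stayIn {A : ℕ → Set E} (hA : ∀ i, MeasurableSet (A i)) (n : ℕ) :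
    MeasurableSet (stayIn A n) := by
  have : stayIn A n = ⋂ i, ⋂ (_ : i ≤ n), (fun ω : ℕ → E => ω i) ⁻¹' A i := by
    ext ω; simp [stayIn]
  rw [this]
  exact .iInter fun i => .iInter fun _ => measurable_pi_apply i (hA i)

instance (P : Kernel E E) [IsMarkovKernel P] (x : E) : IsProbabilityMeasure (pathLaw P x) := by
  unfold pathLaw; infer_instance

theorem pathLaw_stayIn_zero (P : Kernel E E) [IsMarkovKernel P] {x : E} {A : ℕ → Set E}
    (hA : ∀ i, MeasurableSet (A i)) (hx : x ∈ A 0) : pathLaw P x (stayIn A 0) = 1 := by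
  have hpre : stayIn A 0 = Preorder.frestrictLe (π := fun _ : ℕ => E) 0 ⁻¹'
      {h | h ⟨0, Finset.mem_Iic.2 le_rfl⟩ ∈ A 0} := by
    ext ω; simp [stayIn]
  have hm : MeasurableSet {h : Finset.Iic 0 → E | h ⟨0, Finset.mem_Iic.2 le_rfl⟩ ∈ A 0} :=
    measurable_pi_apply _ (hA 0)
  rw [hpre, ← Measure.map_apply (by fun_prop) hm, pathLaw, Kernel.traj_map_frestrictLe_apply,
    Kernel.partialTraj_self, Kernel.id_apply, Measure.dirac_apply' _ hm]
  simp [hx]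

/-- The Markov property at the last step. -/
theorem pathLaw_stayIn_succ (P : Kernel E E) [IsMarkovKernel P] (x : E) {A : ℕ → Set E}
    (hA : ∀ i, MeasurableSet (A i)) (n : ℕ) :
    pathLaw P x (stayIn A (n + 1)) = ∫⁻ ω in stayIn A n, P (ω n) (A (n + 1)) ∂(pathLaw P x) := by
  set κ : (n : ℕ) → Kernel (Finset.Iic n → E) E := fun n =>
    P.comap (fun h : Finset.Iic n → E => h ⟨n, Finset.mem_Iic.2 le_rfl⟩) (measurable_pi_apply _)
  set T : Set (Finset.Iic n → E) := {h | ∀ i : Finset.Iic n, h i ∈ A i}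
  have hT : MeasurableSet T := by
    have : T = ⋂ i, (fun h : Finset.Iic n → E => h i) ⁻¹' A i := by ext; simp [T]
    rw [this]
    exact .iInter fun i => measurable_pi_apply i (hA i)
  have hpre : stayIn A n = Preorder.frestrictLe (π := fun _ : ℕ => E) n ⁻¹' T := by
    ext ω; simp [stayIn, T]
  have hsucc : stayIn A (n + 1) =
      (fun ω : ℕ → E => (Preorder.frestrictLe (π := fun _ : ℕ => E) n ω, ω (n + 1))) ⁻¹'
        (T ×ˢ A (n + 1)) := by
    ext ω
    simp only [stayIn, Set.mem_ofPred_eq, Set.mem_preimage, Set.mem_prod, T,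
      Preorder.frestrictLe_apply, Subtype.forall, Finset.mem_Iic]
    refine ⟨fun h => ⟨fun i hi => h i (by omega), h _ le_rfl⟩, fun h i hi => ?_⟩
    rcases Nat.le_succ_iff.1 hi with hi | rfl
    exacts [h.1 i hi, h.2]
  have key := Kernel.partialTraj_compProd_eq_map_traj (X := fun _ => E) (κ := κ) (Nat.zero_le n)
    (x₀ := fun _ => x)
  have hmeas : Measurable fun h : Finset.Iic n → E => κ n h (A (n + 1)) :=
    (κ n).measurable_coe (hA _)
  rw [hsucc, hpre, ← Measure.map_apply (by fun_prop) (hT.prod (hA _))]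
  change (Kernel.traj (X := fun _ => E) κ 0 fun _ => x).map _ _ = _
  rw [← key, Measure.compProd_apply_prod hT (hA _),
    ← Kernel.traj_map_frestrictLe_apply, setLIntegral_map hT hmeas (by fun_prop)]
  rfl

theorem mul_pathLaw_stayIn_le (P : Kernel E E) [IsMarkovKernel P] (x : E) {A : ℕ → Set E}
    (hA : ∀ i, MeasurableSet (A i)) {n : ℕ} {c : ℝ≥0∞} (hc : ∀ y ∈ A n, c ≤ P y (A (n + 1))) :
    c * pathLaw P x (stayIn A n) ≤ pathLaw P x (stayIn A (n + 1)) := by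
  rw [pathLaw_stayIn_succ P x hA, ← setLIntegral_const]
  exact setLIntegral_mono' (measurableSet_stayIn hA n) fun ω hω => hc _ (hω n le_rfl)

theorem pathLaw_stayIn_succ_le (P : Kernel E E) [IsMarkovKernel P] (x : E) {A : ℕ → Set E}
    (hA : ∀ i, MeasurableSet (A i)) {n : ℕ} {c : ℝ≥0∞} (hc : ∀ y ∈ A n, P y (A (n + 1)) ≤ c) :
    pathLaw P x (stayIn A (n + 1)) ≤ c * pathLaw P x (stayIn A n) := by
  rw [pathLaw_stayIn_succ P x hA, ← setLIntegral_const]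
  exact setLIntegral_mono' (measurableSet_stayIn hA n) fun ω hω => hc _ (hω n le_rfl)

theorem pow_mul_pathLaw_stayIn_le (P : Kernel E E) [IsMarkovKernel P] (x : E) {A : ℕ → Set E}
    (hA : ∀ i, MeasurableSet (A i)) {m : ℕ} {c : ℝ≥0∞}
    (hc : ∀ n, m ≤ n → ∀ y ∈ A n, c ≤ P y (A (n + 1))) (n : ℕ) :
    c ^ n * pathLaw P x (stayIn A m) ≤ pathLaw P x (stayIn A (m + n)) := by
  induction n with
  | zero => simp
  | succ n ih =>
    calc c ^ (n + 1) * pathLaw P x (stayIn A m) = c * (c ^ n * pathLaw P x (stayIn A m)) := by ring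
      _ ≤ c * pathLaw P x (stayIn A (m + n)) := by gcongr
      _ ≤ _ := mul_pathLaw_stayIn_le P x hA (hc _ (by omega))

theorem pathLaw_stayIn_succ_pos (P : Kernel E E) [IsMarkovKernel P] (x : E) {A : ℕ → Set E}
    (hA : ∀ i, MeasurableSet (A i)) {n : ℕ} (hn : 0 < pathLaw P x (stayIn A n))
    (hpos : ∀ y ∈ A n, 0 < P y (A (n + 1))) : 0 < pathLaw P x (stayIn A (n + 1)) := by
  have hmeas : Measurable fun ω : ℕ → E => P (ω n) (A (n + 1)) :=
    (P.measurable_coe (hA _)).comp (measurable_pi_apply n)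
  rw [pathLaw_stayIn_succ P x hA, setLIntegral_pos_iff hmeas]
  refine hn.trans_le (measure_mono fun ω hω => ⟨?_, hω⟩)
  exact (hpos _ (hω n le_rfl)).ne'

theorem lt_returnTime_of_mem_stayIn {F : Type*} {C : Set F} {A : ℕ → Set F}
    (hAC : ∀ i, 1 ≤ i → Disjoint (A i) C) {n : ℕ} {ω : ℕ → F} (hω : ω ∈ stayIn A n) :
    (n : ℕ∞) < returnTime C ω := by
  by_contra h
  have h' : hittingAfter (fun (n : ℕ) (ω : ℕ → F) => ω n) C 1 ω ≤ (n : WithTop ℕ) := not_lt.1 h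
  obtain ⟨j, hj, hjC⟩ := hittingAfter_le_iff.1 h'
  exact Set.disjoint_left.1 (hAC j hj.1) (hω j hj.2) hjC

theorem mul_pathLaw_stayIn_le_meanReturnTime (P : Kernel E E) [IsMarkovKernel P] (x : E)
    {C : Set E} {A : ℕ → Set E} (hA : ∀ i, MeasurableSet (A i))
    (hAC : ∀ i, 1 ≤ i → Disjoint (A i) C) (n : ℕ) :
    n * pathLaw P x (stayIn A n) ≤ meanReturnTime P C x := by
  rw [← lintegral_indicator_const (measurableSet_stayIn hA n)]
  refine lintegral_mono (Set.indicator_le fun ω hω => ?_)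
  have := (lt_returnTime_of_mem_stayIn hAC hω).le
  exact_mod_cast ENat.toENNReal_le.2 this

theorem pow_mul_pathLaw_stayIn_le_expReturnTime (P : Kernel E E) [IsMarkovKernel P] (x : E)
    {C : Set E} {A : ℕ → Set E} (hA : ∀ i, MeasurableSet (A i))
    (hAC : ∀ i, 1 ≤ i → Disjoint (A i) C) {r : ℝ} (hr : 1 ≤ r) (n : ℕ) :
    ENNReal.ofReal r ^ n * pathLaw P x (stayIn A n) ≤ expReturnTime P r C x := by
  rw [← lintegral_indicator_const (measurableSet_stayIn hA n)]
  refine lintegral_mono (Set.indicator_le fun ω hω => ?_)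
  have hlt := (lt_returnTime_of_mem_stayIn hAC hω).le
  unfold powTime
  split_ifs with h
  · exact le_top
  · refine pow_le_pow_right₀ (by simpa using hr) ?_
    rw [← ENat.natCast_toNat h] at hlt
    exact_mod_cast hlt

/-- Tail-sum formula: `𝔼 τ = ∑ ℙ(τ > n)`, and a path with `τ > n` avoids `C` at times `1, …, n`,
hence lies in `stayIn A n`. -/
theorem meanReturnTime_le_tsum (P : Kernel E E) [IsMarkovKernel P] (x : E)
    {C : Set E} {A : ℕ → Set E} (hA : ∀ i, MeasurableSet (A i))
    (hAC : ∀ i, 1 ≤ i → Cᶜ ⊆ A i) (hA0 : A 0 = Set.univ) :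
    meanReturnTime P C x ≤ ∑' n, pathLaw P x (stayIn A n) := by
  have hpt : ∀ ω : ℕ → E,
      (returnTime C ω : ℝ≥0∞) ≤ ∑' n, (stayIn A n).indicator (1 : (ℕ → E) → ℝ≥0∞) ω := by
    intro ω
    have hmem : ∀ n : ℕ, (n : ℕ∞) < returnTime C ω → ω ∈ stayIn A n := by
      intro n hn i hi
      rcases Nat.eq_zero_or_pos i with rfl | hi0
      · simp [hA0]
      · refine hAC i hi0
          (notMem_of_lt_hittingAfter (u := fun (n : ℕ) (ω : ℕ → E) => ω n) (n := 1) ?_ hi0)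
        exact lt_of_le_of_lt (WithTop.coe_le_coe.2 hi) hn
    have hle : ∀ m : ℕ, (m : ℕ∞) ≤ returnTime C ω →
        (m : ℝ≥0∞) ≤ ∑' n, (stayIn A n).indicator (1 : (ℕ → E) → ℝ≥0∞) ω := by
      intro m hm
      calc (m : ℝ≥0∞) = ∑ n ∈ Finset.range m, 1 := by simp
        _ = ∑ n ∈ Finset.range m, (stayIn A n).indicator (1 : (ℕ → E) → ℝ≥0∞) ω := by
          refine Finset.sum_congr rfl fun n hn => ?_
          rw [Set.indicator_of_mem (hmem n (lt_of_lt_of_le _ hm))]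
          · rfl
          · exact_mod_cast Finset.mem_range.1 hn
        _ ≤ _ := ENNReal.sum_le_tsum _
    rcases eq_or_ne (returnTime C ω) ⊤ with h | h
    · rw [h] at hle ⊢
      refine le_of_eq_of_le ?_ (ENNReal.iSup_natCast ▸ iSup_le fun m => hle m le_top)
      rfl
    · have := hle _ (ENat.natCast_toNat h).le
      rw [← ENat.natCast_toNat h]
      exact_mod_cast this
  calc meanReturnTime P C x
      ≤ ∫⁻ ω, ∑' n, (stayIn A n).indicator (1 : (ℕ → E) → ℝ≥0∞) ω ∂(pathLaw P x) :=
        lintegral_mono hpt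
    _ = _ := by
      rw [lintegral_tsum fun n =>
        (measurable_one.indicator (measurableSet_stayIn hA n)).aemeasurable]
      exact tsum_congr fun n => lintegral_indicator_one (measurableSet_stayIn hA n)

/-- A singleton is petite. -/
theorem isPetite_singleton [MeasurableSingletonClass E] (P : Kernel E E) (x : E) :
    IsPetite P {x} := by
  -- All weight sits on `n = 0`, where `P ^ 0` is the identity kernel.
  refine ⟨measurableSet_singleton x, Pi.single 0 1, Measure.dirac x, tsum_pi_single 0 1,
    IsProbabilityMeasure.ne_zero _, ?_⟩
  rintro _ rfl B hB
  refine le_trans ?_ (ENNReal.le_tsum 0)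
  simp only [Pi.single_eq_same, one_mul, pow_zero]
  exact le_rfl

theorem isMarkovKernel_pow (P : Kernel E E) [IsMarkovKernel P] (n : ℕ) :
    IsMarkovKernel (P ^ n) := by
  induction n with
  | zero => exact inferInstanceAs (IsMarkovKernel (Kernel.id : Kernel E E))
  | succ n ih => exact inferInstanceAs (IsMarkovKernel ((P ^ n) ∘ₖ P))

end General

end MarkovErgodicity

namespace MarkovErgodicity.ChainParams

variable (D : ChainParams)

/-! ### One-step bounds and the killing probability -/

theorem kernel_apply_of_ne_zero {x : ℝ≥0} (hx : x ≠ 0) :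
    D.kernel x = ENNReal.ofReal (D.γ x) • Measure.dirac 0
      + ENNReal.ofReal (D.b x) • Measure.dirac (x + 1)
      + ENNReal.ofReal (1 - D.γ x - D.b x) • Measure.dirac x :=
  if_neg hx

theorem kernel_zero_singleton_zero : D.kernel 0 {0} = 0 := by
  have h0 : lebesgue {0} = 0 := by
    have hemb : MeasurableEmbedding NNReal.toReal :=
      MeasurableEmbedding.subtype_coe measurableSet_Ici
    rw [lebesgue, hemb.comap_apply, Set.image_singleton, measure_singleton]
  have h1 : D.kernel 0 = lebesgue.withDensity fun y => (D.β y : ℝ≥0∞) := if_pos rfl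
  rw [h1]
  exact withDensity_absolutelyContinuous _ _ h0

theorem kernel_zero_Ioi_zero : D.kernel 0 (Set.Ioi 0) = 1 := by
  have h : (Set.Ioi 0 : Set ℝ≥0) = {0}ᶜ := by ext; simp [pos_iff_ne_zero]
  rw [h, prob_compl_eq_one_iff (measurableSet_singleton 0), D.kernel_zero_singleton_zero]

theorem ofReal_b_le_kernel {x : ℝ≥0} (hx : x ≠ 0) {A : Set ℝ≥0} (hA : x + 1 ∈ A) :
    ENNReal.ofReal (D.b x) ≤ D.kernel x A := by
  rw [D.kernel_apply_of_ne_zero hx]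
  simp only [Measure.add_apply, Measure.smul_apply, smul_eq_mul, Measure.dirac_apply,
    Set.indicator_of_mem hA, Pi.one_apply, mul_one]
  exact (le_add_self (a := ENNReal.ofReal (D.b x))).trans le_self_add

theorem ofReal_one_sub_γ_le_kernel {x : ℝ≥0} (hx : x ≠ 0) {A : Set ℝ≥0} (hA : x ∈ A)
    (hA' : x + 1 ∈ A) : ENNReal.ofReal (1 - D.γ x) ≤ D.kernel x A := by
  have h : ENNReal.ofReal (1 - D.γ x) =
      ENNReal.ofReal (D.b x) + ENNReal.ofReal (1 - D.γ x - D.b x) := by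
    rw [← ENNReal.ofReal_add (D.b_pos x).le (by linarith [D.add_le_one x]), add_sub_cancel]
  rw [D.kernel_apply_of_ne_zero hx, h]
  simp only [Measure.add_apply, Measure.smul_apply, smul_eq_mul, Measure.dirac_apply,
    Set.indicator_of_mem hA, Set.indicator_of_mem hA', Pi.one_apply, mul_one, add_assoc]
  exact le_add_self

theorem kernel_compl_zero_le {x : ℝ≥0} (hx : x ≠ 0) :
    D.kernel x {0}ᶜ ≤ ENNReal.ofReal (1 - D.γ x) := by
  rw [prob_compl_eq_one_sub (measurableSet_singleton 0), ENNReal.ofReal_sub _ (D.γ_pos x).le,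
    ENNReal.ofReal_one, D.kernel_apply_of_ne_zero hx]
  refine tsub_le_tsub_left ?_ _
  simp only [Measure.add_apply, Measure.smul_apply, smul_eq_mul, Measure.dirac_apply,
    Set.indicator_of_mem (Set.mem_singleton (0 : ℝ≥0)), Pi.one_apply, mul_one, add_assoc]
  exact le_self_add

theorem tendsto_γ (h : limsup D.γ atTop = 0) : Tendsto D.γ atTop (nhds 0) := by
  have hb : IsBoundedUnder (· ≤ ·) atTop D.γ := isBoundedUnder_of ⟨1, D.γ_le_one⟩
  have hb' : IsBoundedUnder (· ≥ ·) atTop D.γ := isBoundedUnder_of ⟨0, fun x => (D.γ_pos x).le⟩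
  refine tendsto_of_le_liminf_of_limsup_le ?_ h.le hb hb'
  exact le_liminf_of_le hb.isCoboundedUnder_ge (Eventually.of_forall fun x => (D.γ_pos x).le)

theorem exists_pos_forall_le_γ (h : 0 < liminf D.γ atTop) : ∃ g > 0, ∀ x, g ≤ D.γ x := by
  have hb' : IsBoundedUnder (· ≥ ·) atTop D.γ := isBoundedUnder_of ⟨0, fun x => (D.γ_pos x).le⟩
  obtain ⟨g, hg0, hg⟩ := exists_between h
  obtain ⟨L, hL⟩ := eventually_atTop.1 (eventually_lt_of_lt_liminf hg hb')
  -- On the compact part `[0, L]` the continuous positive `γ` attains a positive minimum.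
  obtain ⟨z, -, hz⟩ := isCompact_Icc.exists_isMinOn (Set.nonempty_Icc.2 (zero_le (a := L)))
    D.continuous_γ.continuousOn
  refine ⟨min g (D.γ z), lt_min hg0 (D.γ_pos z), fun x => ?_⟩
  rcases le_total x L with hx | hx
  · exact (min_le_right _ _).trans (hz ⟨zero_le, hx⟩)
  · exact (min_le_left _ _).trans (hL x hx).le

/-! ### Strong ergodicity -/

theorem meanReturnTime_zero_le {g : ℝ} (hg : ∀ x, g ≤ D.γ x) (x : ℝ≥0) :
    meanReturnTime D.kernel {0} x ≤ 1 + (1 - ENNReal.ofReal (1 - g))⁻¹ := by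
  set A : ℕ → Set ℝ≥0 := fun i => if i = 0 then Set.univ else {0}ᶜ
  have hA : ∀ i, MeasurableSet (A i) := by
    intro i
    rcases Nat.eq_zero_or_pos i with rfl | hi
    · simp [A]
    · simp [A, hi.ne']
  -- The exponent lags by one: the start may be `0`, from which the first step is not killed.
  have hbound : ∀ n, pathLaw D.kernel x (stayIn A (n + 1)) ≤ ENNReal.ofReal (1 - g) ^ n := by
    intro n
    induction n with
    | zero => simpa using prob_le_one
    | succ n ih =>
      rw [pow_succ']
      refine (pathLaw_stayIn_succ_le _ _ hA (c := ENNReal.ofReal (1 - g)) fun y hy => ?_).trans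
        (by gcongr)
      have hy0 : y ≠ 0 := by simpa [A] using hy
      simp only [A, Nat.succ_ne_zero, if_false]
      refine (D.kernel_compl_zero_le hy0).trans (ENNReal.ofReal_le_ofReal ?_)
      linarith [hg y]
  refine (meanReturnTime_le_tsum _ _ hA (fun i hi => ?_) (by simp [A])).trans ?_
  · simp [A, (Nat.one_le_iff_ne_zero.1 hi)]
  · rw [tsum_eq_zero_add' ENNReal.summable, ← ENNReal.tsum_geometric]
    exact add_le_add prob_le_one (ENNReal.tsum_le_tsum hbound)

theorem isStronglyErgodic_of_liminf_pos (h : 0 < liminf D.γ atTop) :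
    IsStronglyErgodic D.kernel := by
  obtain ⟨g, hg0, hg⟩ := D.exists_pos_forall_le_γ h
  refine ⟨{0}, isPetite_singleton _ 0,
    (iSup_le fun x => D.meanReturnTime_zero_le hg x).trans_lt ?_⟩
  refine ENNReal.add_lt_top.2 ⟨ENNReal.one_lt_top, ENNReal.inv_lt_top.2 (tsub_pos_of_lt ?_)⟩
  exact ENNReal.ofReal_lt_one.2 (by linarith)

/-! ### Petite sets are bounded when killing vanishes at infinity -/

theorem tendsto_kernel_pow_Iio (h : Tendsto D.γ atTop (nhds 0)) (M : ℝ≥0) (n : ℕ) :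
    Tendsto (fun x => (D.kernel ^ n) x (Set.Iio M)) atTop (nhds 0) := by
  have := isMarkovKernel_pow D.kernel
  induction n with
  | zero =>
    refine tendsto_const_nhds.congr' ?_
    filter_upwards [eventually_ge_atTop M] with x hx
    rw [pow_zero]
    change 0 = Measure.dirac x (Set.Iio M)
    simp [hx]
  | succ n ih =>
    have hγ : Tendsto (fun x => ENNReal.ofReal (D.γ x)) atTop (nhds 0) := by
      simpa using ENNReal.tendsto_ofReal h
    -- Decompose by the first step: to `0` (cost at most `γ x`), to `x + 1`, or staying at `x`.
    have hlim : Tendsto (fun x => ENNReal.ofReal (D.γ x) + (D.kernel ^ n) (x + 1) (Set.Iio M)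
        + (D.kernel ^ n) x (Set.Iio M)) atTop (nhds 0) := by
      have hshift : Tendsto (fun x : ℝ≥0 => x + 1) atTop atTop :=
        tendsto_atTop_mono (fun x => le_self_add) tendsto_id
      simpa using (hγ.add (ih.comp hshift)).add ih
    refine tendsto_of_tendsto_of_tendsto_of_le_of_le' tendsto_const_nhds hlim
      (Eventually.of_forall fun _ => zero_le) ?_
    filter_upwards [eventually_gt_atTop 0] with x hx
    rw [add_comm n 1, Kernel.pow_add_apply_eq_lintegral _ 1 n x measurableSet_Iio, pow_one,
      D.kernel_apply_of_ne_zero hx.ne']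
    simp only [lintegral_add_measure, lintegral_smul_measure, lintegral_dirac, smul_eq_mul]
    gcongr
    · exact mul_le_of_le_one_right' prob_le_one
    · exact mul_le_of_le_one_left' (by simpa using D.b_le_one x)
    · refine mul_le_of_le_one_left' ?_
      simpa using by linarith [D.γ_pos x, D.b_pos x]

/-- If the killing probability vanishes at infinity, then petite sets are bounded. -/
theorem bddAbove_of_isPetite (h : Tendsto D.γ atTop (nhds 0)) {C : Set ℝ≥0}
    (hC : IsPetite D.kernel C) : BddAbove C := by
  have := isMarkovKernel_pow D.kernel
  by_contra hunb
  obtain ⟨-, a, ν, ha, hν, hCν⟩ := hC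
  have hfreq : ∃ᶠ x in atTop, x ∈ C := by
    rw [frequently_atTop]
    intro L
    obtain ⟨x, hx, hLx⟩ := not_bddAbove_iff.1 hunb L
    exact ⟨x, hLx.le, hx⟩
  have hzero : ∀ M : ℕ, ν (Set.Iio (M : ℝ≥0)) = 0 := by
    intro M
    have hlim : Tendsto (fun x => ∑' n, a n * (D.kernel ^ n) x (Set.Iio (M : ℝ≥0))) atTop
        (nhds 0) := by
      have hane : ∀ n, a n ≠ ⊤ := fun n =>
        ((ENNReal.le_tsum n).trans_lt (ha ▸ ENNReal.one_lt_top)).ne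
      -- The series is an integral for counting measure, dominated by the summable weights `a`.
      have := tendsto_lintegral_filter_of_dominated_convergence (μ := Measure.count) (l := atTop)
        (F := fun (x : ℝ≥0) n => a n * (D.kernel ^ n) x (Set.Iio (M : ℝ≥0))) (f := fun _ => 0) a
        (Eventually.of_forall fun _ => measurable_of_countable _)
        (Eventually.of_forall fun x => ae_of_all _ fun n => mul_le_of_le_one_right' prob_le_one)
        (by rw [lintegral_count, ha]; exact ENNReal.one_ne_top)
        (ae_of_all _ fun n => by
          simpa using ENNReal.Tendsto.const_mul (D.tendsto_kernel_pow_Iio h M n)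
            (Or.inr (hane n)))
      simpa only [lintegral_count, tsum_zero] using this
    refine nonpos_iff_eq_zero.1 ?_
    exact ge_of_tendsto_of_frequently hlim (hfreq.mono fun x hx => hCν x hx _ measurableSet_Iio)
  refine hν (Measure.measure_univ_eq_zero.1 ?_)
  have huniv : (Set.univ : Set ℝ≥0) = ⋃ M : ℕ, Set.Iio (M : ℝ≥0) := by
    refine (Set.eq_univ_of_forall fun x => ?_).symm
    obtain ⟨M, hM⟩ := exists_nat_gt x
    exact Set.mem_iUnion.2 ⟨M, hM⟩
  rw [huniv]
  exact measure_iUnion_null hzero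

/-! ### Long survival at high levels: failure of ergodicity -/

theorem ofReal_le_kernel_Ici {ε : ℝ} {L : ℝ≥0} (hL0 : 0 < L) (hL : ∀ x, L ≤ x → D.γ x ≤ ε)
    {l y : ℝ≥0} (hl : L ≤ l) (hy : l ≤ y) : ENNReal.ofReal (1 - ε) ≤ D.kernel y (Set.Ici l) := by
  refine le_trans (ENNReal.ofReal_le_ofReal ?_) (D.ofReal_one_sub_γ_le_kernel
    (hL0.trans_le (hl.trans hy)).ne' hy (hy.trans le_self_add))
  linarith [hL y (hl.trans hy)]

theorem exists_forall_γ_le (h : Tendsto D.γ atTop (nhds 0)) {C : Set ℝ≥0} (hC : BddAbove C)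
    {ε : ℝ} (hε : 0 < ε) :
    ∃ L : ℝ≥0, 0 < L ∧ (∀ x, L ≤ x → D.γ x ≤ ε) ∧ ∀ l, L ≤ l → Disjoint (Set.Ici l) C := by
  obtain ⟨M, hM⟩ := hC
  obtain ⟨L, hL⟩ := eventually_atTop.1 (h.eventually (eventually_le_nhds hε))
  refine ⟨max L (M + 1), by positivity, fun x hx => hL x ((le_max_left _ _).trans hx),
    fun l hl => Set.disjoint_left.2 fun x hx hxC => ?_⟩
  have h1 : M + 1 ≤ M := ((le_max_right _ _).trans hl).trans (le_trans hx (hM hxC))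
  exact absurd h1 (by simp)

theorem not_isStronglyErgodic (h : Tendsto D.γ atTop (nhds 0)) :
    ¬ IsStronglyErgodic D.kernel := by
  rintro ⟨C, hC, hsup⟩
  have hbdd := D.bddAbove_of_isPetite h hC
  have hge : ∀ n : ℕ, (n : ℝ≥0∞) * ENNReal.ofReal (1 / 2) ≤
      ⨆ x, meanReturnTime D.kernel C x := by
    intro n
    -- Small enough that Bernoulli gives `(1 - ε)^n ≥ 1 - n ε ≥ 1/2`.
    set ε : ℝ := 1 / (2 * (n + 1)) with hε
    have hε0 : 0 < ε := by positivity
    have hn : n * ε ≤ 1 / 2 := by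
      rw [hε, mul_one_div, div_le_div_iff₀ (by positivity) (by positivity)]
      linarith
    have hε1 : ε ≤ 1 / 2 := by
      rw [hε, div_le_div_iff₀ (by positivity) (by positivity)]
      linarith [(Nat.cast_nonneg n : (0 : ℝ) ≤ n)]
    obtain ⟨L, hL0, hL, hLC⟩ := D.exists_forall_γ_le h hbdd hε0
    have hA : ∀ _ : ℕ, MeasurableSet (Set.Ici L) := fun _ => measurableSet_Ici
    have hpow := pow_mul_pathLaw_stayIn_le D.kernel L hA (m := 0) (c := ENNReal.ofReal (1 - ε))
      (fun _ _ y hy => D.ofReal_le_kernel_Ici hL0 hL le_rfl hy) n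
    rw [pathLaw_stayIn_zero D.kernel hA Set.self_mem_Ici, mul_one, zero_add,
      ← ENNReal.ofReal_pow (by linarith)] at hpow
    have hbern : 1 / 2 ≤ (1 - ε) ^ n := by
      have := one_add_mul_le_pow (a := -ε) (by linarith) n
      rw [← sub_eq_add_neg] at this
      linarith
    calc (n : ℝ≥0∞) * ENNReal.ofReal (1 / 2)
        ≤ n * pathLaw D.kernel L (stayIn (fun _ => Set.Ici L) n) := by
          gcongr
          exact (ENNReal.ofReal_le_ofReal hbern).trans hpow
      _ ≤ meanReturnTime D.kernel C L :=
          mul_pathLaw_stayIn_le_meanReturnTime _ _ hA (fun _ _ => hLC L le_rfl) n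
      _ ≤ _ := le_iSup (fun x => meanReturnTime D.kernel C x) L
  refine hsup.ne (top_le_iff.1 ?_)
  have htop : Tendsto (fun n : ℕ => (n : ℝ≥0∞) * ENNReal.ofReal (1 / 2)) atTop (nhds ⊤) := by
    have := ENNReal.Tendsto.mul_const (b := ENNReal.ofReal (1 / 2))
      ENNReal.tendsto_nat_nhds_top (Or.inl ENNReal.top_ne_zero)
    rwa [ENNReal.top_mul (by simp)] at this
  exact le_of_tendsto' htop hge

/-- If the chain started at `x` can climb to infinity along sets `B j` that miss the bounded set
`C`, then its return time to `C` has no exponential moment. -/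
theorem expReturnTime_eq_top (h : Tendsto D.γ atTop (nhds 0)) {C : Set ℝ≥0} (hC : BddAbove C)
    {r : ℝ} (hr : 1 < r) {x : ℝ≥0} {B : ℕ → Set ℝ≥0} (hB : ∀ j, MeasurableSet (B j))
    (hBC : ∀ j, Disjoint (B j) C) (hxB : 0 < D.kernel x (B 0))
    (hsucc : ∀ j, ∀ y ∈ B j, y + 1 ∈ B (j + 1)) (hne : ∀ j, ∀ y ∈ B j, y ≠ 0)
    (hge : ∀ j : ℕ, ∀ y ∈ B j, (j : ℝ≥0) ≤ y) :
    expReturnTime D.kernel r C x = ⊤ := by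
  -- Chosen so that `r (1 - ε)` is the midpoint of `1` and `r`.
  set ε : ℝ := (r - 1) / (2 * r) with hε
  have hε0 : 0 < ε := div_pos (by linarith) (by linarith)
  have hrε : r * (1 - ε) = (r + 1) / 2 := by
    rw [hε]; field_simp; ring
  obtain ⟨L, hL0, hL, hLC⟩ := D.exists_forall_γ_le h hC hε0
  obtain ⟨k, hk⟩ := exists_nat_ge L
  -- Climb through `B 0, …, B k` at times `1, …, k + 1`, then remain above `k ≥ L`; the phases join
  -- because `B k ⊆ Set.Ici k`.
  set A : ℕ → Set ℝ≥0 := fun i =>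
    if i = 0 then {x} else if i ≤ k + 1 then B (i - 1) else Set.Ici (k : ℝ≥0)
  have hA0 : A 0 = {x} := if_pos rfl
  have hAB : ∀ j ≤ k, A (j + 1) = B j := fun j hj => by simp [A, hj]
  have hAk : ∀ j, k < j → A (j + 1) = Set.Ici (k : ℝ≥0) := fun j hj => by simp [A, hj]
  have hA : ∀ i, MeasurableSet (A i) := by
    rintro (_ | j)
    · rw [hA0]; exact measurableSet_singleton x
    · rcases le_or_gt j k with hj | hj
      · rw [hAB j hj]; exact hB j
      · rw [hAk j hj]; exact measurableSet_Ici
  have hAC : ∀ i, 1 ≤ i → Disjoint (A i) C := by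
    rintro (_ | j) hi
    · omega
    · rcases le_or_gt j k with hj | hj
      · rw [hAB j hj]; exact hBC j
      · rw [hAk j hj]; exact hLC _ hk
  have hpos : ∀ j ≤ k, 0 < pathLaw D.kernel x (stayIn A (j + 1)) := by
    intro j
    induction j with
    | zero =>
      intro _
      refine pathLaw_stayIn_succ_pos _ _ hA ?_ fun y hy => ?_
      · rw [pathLaw_stayIn_zero _ hA (by simp [hA0])]; exact one_pos
      · rw [hA0, Set.mem_singleton_iff] at hy
        rwa [hAB 0 (Nat.zero_le k), hy]
    | succ j ih =>
      intro hj
      refine pathLaw_stayIn_succ_pos _ _ hA (ih (by omega)) fun y hy => ?_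
      rw [hAB j (by omega)] at hy
      rw [hAB _ hj]
      exact (ENNReal.ofReal_pos.2 (D.b_pos y)).trans_le
        (D.ofReal_b_le_kernel (hne j y hy) (hsucc j y hy))
  have hstay : ∀ n, k + 1 ≤ n → ∀ y ∈ A n, ENNReal.ofReal (1 - ε) ≤ D.kernel y (A (n + 1)) := by
    rintro (_ | n) hn y hy
    · omega
    rw [hAk _ (by omega)]
    refine D.ofReal_le_kernel_Ici hL0 hL hk ?_
    rcases eq_or_lt_of_le (Nat.le_of_succ_le_succ hn) with rfl | hlt
    · rw [hAB k le_rfl] at hy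
      exact hge k y hy
    · rwa [hAk n hlt] at hy
  set p := pathLaw D.kernel x (stayIn A (k + 1))
  have hle : ∀ n : ℕ, ENNReal.ofReal ((r + 1) / 2) ^ n * p ≤ expReturnTime D.kernel r C x := by
    intro n
    calc ENNReal.ofReal ((r + 1) / 2) ^ n * p
        = ENNReal.ofReal r ^ n * (ENNReal.ofReal (1 - ε) ^ n * p) := by
          rw [← hrε, ENNReal.ofReal_mul (by linarith), mul_pow, mul_assoc]
      _ ≤ ENNReal.ofReal r ^ (k + 1 + n) * pathLaw D.kernel x (stayIn A (k + 1 + n)) := by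
          gcongr
          · simpa using hr.le
          · omega
          · exact pow_mul_pathLaw_stayIn_le _ _ hA hstay n
      _ ≤ _ := pow_mul_pathLaw_stayIn_le_expReturnTime _ _ hA hAC hr.le _
  have htop : Tendsto (fun n : ℕ => ENNReal.ofReal ((r + 1) / 2) ^ n * p) atTop (nhds ⊤) := by
    have h1 : 1 < ENNReal.ofReal ((r + 1) / 2) := ENNReal.one_lt_ofReal.2 (by linarith)
    have := ENNReal.Tendsto.mul_const (b := p)
      (ENNReal.tendsto_pow_atTop_nhds_top_iff.2 h1) (Or.inl ENNReal.top_ne_zero)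
    rwa [ENNReal.top_mul (hpos k le_rfl).ne'] at this
  exact top_le_iff.1 (le_of_tendsto' htop hle)

/-- Take the last point of `x + ℕ` in `C`; from it, unit jumps never meet `C` again. -/
theorem exists_mem_forall_add_notMem {C : Set ℝ≥0} (hC : BddAbove C) {x : ℝ≥0} (hx : x ∈ C) :
    ∃ y ∈ C, x ≤ y ∧ ∀ j : ℕ, y + 1 + j ∉ C := by
  classical
  obtain ⟨M, hM⟩ := hC
  obtain ⟨N, hN⟩ := exists_nat_ge M
  have hbound : ∀ j : ℕ, x + j ∈ C → j ≤ N := fun j hj => by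
    have : (j : ℝ≥0) ≤ N := (le_add_self.trans (hM hj)).trans hN
    exact_mod_cast this
  have hex : x + (0 : ℕ) ∈ C := by simpa using hx
  refine ⟨x + (Nat.findGreatest (fun j : ℕ => x + j ∈ C) N : ℕ),
    Nat.findGreatest_spec (P := fun j : ℕ => x + j ∈ C) (Nat.zero_le N) hex, le_self_add,
    fun j hj => ?_⟩
  have hj' : x + ((Nat.findGreatest (fun j : ℕ => x + j ∈ C) N + 1 + j : ℕ) : ℝ≥0) ∈ C := by
    push_cast
    simpa only [add_assoc] using hj
  have := Nat.le_findGreatest (P := fun j : ℕ => x + j ∈ C) (hbound _ hj') hj'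
  omega

theorem not_isGeometricallyErgodic (h : Tendsto D.γ atTop (nhds 0)) :
    ¬ IsGeometricallyErgodic D.kernel := by
  rintro ⟨C, ⟨x, hxC⟩, hC, r, hr, hsup⟩
  have hbdd := D.bddAbove_of_isPetite h hC
  suffices ∃ y ∈ C, expReturnTime D.kernel r C y = ⊤ by
    obtain ⟨y, hy, htop⟩ := this
    refine hsup.ne (top_le_iff.1 (htop ▸ ?_))
    exact le_iSup₂ (f := fun x (_ : x ∈ C) => expReturnTime D.kernel r C x) y hy
  by_cases hpos : ∃ z ∈ C, z ≠ 0
  · obtain ⟨z, hz, hz0⟩ := hpos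
    obtain ⟨y, hy, hzy, hyC⟩ := exists_mem_forall_add_notMem hbdd hz
    have hy0 : y ≠ 0 := ((pos_iff_ne_zero.2 hz0).trans_le hzy).ne'
    refine ⟨y, hy, D.expReturnTime_eq_top h hbdd hr (B := fun j => {y + 1 + j})
      (fun j => measurableSet_singleton _) (fun j => Set.disjoint_singleton_left.2 (hyC j)) ?_
      ?_ ?_ ?_⟩
    · exact (ENNReal.ofReal_pos.2 (D.b_pos y)).trans_le (D.ofReal_b_le_kernel hy0 (by simp))
    · rintro j _ rfl
      simp [add_assoc]
    · rintro j _ rfl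
      positivity
    · rintro j _ rfl
      exact le_add_self
  · push Not at hpos
    have hx0 : x = 0 := hpos x hxC
    subst hx0
    -- Here `C = {0}`. The jump from `0` has a density, so singletons are null and open half-lines
    -- replace them.
    refine ⟨0, hxC, D.expReturnTime_eq_top h hbdd hr (B := fun j => Set.Ioi (j : ℝ≥0))
      (fun j => measurableSet_Ioi) (fun j => Set.disjoint_left.2 fun y hy hyC => ?_) ?_ ?_ ?_ ?_⟩
    · rw [hpos y hyC] at hy
      exact not_lt_zero (Set.mem_Ioi.1 hy)
    · simp [D.kernel_zero_Ioi_zero]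
    · intro j y hy
      simpa using hy
    · intro j y hy
      exact (zero_le.trans_lt hy).ne'
    · intro j y hy
      exact le_of_lt hy

end MarkovErgodicity.ChainParams

theorem proposition6 (D : MarkovErgodicity.ChainParams) :
    (limsup D.γ atTop = 0 → ¬ MarkovErgodicity.IsStronglyErgodic D.kernel) ∧
    (0 < liminf D.γ atTop → MarkovErgodicity.IsStronglyErgodic D.kernel) ∧
    (limsup D.γ atTop = 0 → 0 < liminf D.b atTop →
      ¬ MarkovErgodicity.IsGeometricallyErgodic D.kernel) :=
  ⟨fun h => D.not_isStronglyErgodic (D.tendsto_γ h), D.isStronglyErgodic_of_liminf_pos,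
    fun h _ => D.not_isGeometricallyErgodic (D.tendsto_γ h)⟩
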